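/- Let $\mathbb{K}$ be a field of characteristic zero, $S=\mathbb{K}[x,y]$, and let $m_1,m_2,m_3,m_4$ be positive integers. Let $(\mathcal{A},m)$ be the multiarrangement in $\mathbb{K}^2$ with defining polynomial $$Q(\mathcal{A},m)=x^{m_1}y^{m_2}(x-y)^{m_3}(x+y)^{m_4},$$ put $\alpha_1=x$, $\alpha_2=y$, $\alpha_3=x-y$, $\alpha_4=x+y$ and $|m|=m_1+m_2+m_3+m_4$, and let $$D(\mathcal{A},m)=\{\theta\in\operatorname{Der}_{\mathbb{K}}(S)\mid \theta(\alpha_i)\in\alpha_i^{m_i}S\ \text{ for } i=1,2,3,4\}.$$ A derivation $\theta$ is homogeneous of degree $d$ if $\theta(x)$ and $\theta(y)$ are homogeneous polynomials of degree $d$. The $S$-module $D(\mathcal{A},m)$ is free with a basis of two homogeneous derivations; the degrees $(d_1,d_2)$ of such a basis are the exponents of $(\mathcal{A},m)$, and $\Delta(\mathcal{A},m)=|d_1-d_2|$. Assume that $(\mathcal{A},m)$ is balanced, that is, $m_i<|m|/2$ for $i=1,2,3,4$, and that $|m_2-m_1|\ge|m_4-m_3|=0$. Then $\Delta(\mathcal{A},m)=2$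 if and only if $m_1$, $m_2$ and $e:=\frac{|m|}{2}-1$ are all odd integers. -/

import Mathlib

open MvPolynomial

noncomputable section

/-- The logarithmic derivation module `D(A, m)` of the multiarrangement in `K ^ ℓ` whose
hyperplanes are the kernels of the linear forms `α i`, with multiplicities `m i`: the derivations
`θ` of `S = K[x_1, ..., x_ℓ]` with `θ (α i) ∈ (α i) ^ (m i) S` for every `i`. -/
def logDerivations {K : Type*} [Field K] {ℓ : ℕ} {ι : Type*}
    (α : ι → MvPolynomial (Fin ℓ) K) (m : ι → ℕ) :
    Submodule (MvPolynomial (Fin ℓ) K)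
      (Derivation K (MvPolynomial (Fin ℓ) K) (MvPolynomial (Fin ℓ) K)) where
  carrier := {θ | ∀ i, θ (α i) ∈ Ideal.span {α i ^ m i}}
  add_mem' := fun ha hb i => by
    rw [Derivation.add_apply]
    exact Ideal.add_mem _ (ha i) (hb i)
  zero_mem' := fun i => by
    rw [Derivation.zero_apply]
    exact Ideal.zero_mem _
  smul_mem' := fun c θ h i => by
    rw [Derivation.smul_apply, smul_eq_mul]
    exact Ideal.mul_mem_left _ c (h i)

/-- `θ` is homogeneous of (polynomial) degree `d`: all its coefficients `θ (x_j)` with respect to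
`∂/∂x_1, ..., ∂/∂x_ℓ` are homogeneous polynomials of degree `d`. -/
def IsHomogeneousDerivation {K : Type*} [Field K] {ℓ : ℕ}
    (θ : Derivation K (MvPolynomial (Fin ℓ) K) (MvPolynomial (Fin ℓ) K)) (d : ℕ) : Prop :=
  ∀ j, (θ (X j)).IsHomogeneous d

/-- The multiarrangement is free with exponents `d`: `D(A, m)` has an `S`-basis of `ℓ` homogeneous
derivations, of degrees `d 0, ..., d (ℓ - 1)`. -/
def HasExponents {K : Type*} [Field K] {ℓ : ℕ} {ι : Type*}
    (α : ι → MvPolynomial (Fin ℓ) K) (m : ι → ℕ) (d : Fin ℓ → ℕ) : Prop :=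
  ∃ b : Module.Basis (Fin ℓ) (MvPolynomial (Fin ℓ) K) (logDerivations α m),
    ∀ i, IsHomogeneousDerivation (b i).1 (d i)

/-- A multiplicity is balanced if `m(H) < |m| / 2` for every hyperplane `H`. -/
def IsBalanced {ι : Type*} [Fintype ι] (m : ι → ℕ) : Prop :=
  ∀ i, (m i : ℚ) < ((∑ j, m j : ℕ) : ℚ) / 2

/-- The linear forms `x, y, x - y, x + y` defining the Coxeter arrangement of type `B_2`. -/
def formsB2 (K : Type*) [Field K] : Fin 4 → MvPolynomial (Fin 2) K :=
  ![X 0, X 1, X 0 - X 1, X 0 + X 1]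

end

/-! A homogeneous derivation of degree d is determined by f = θ(x)(X, 1) and g = θ(y)(X, 1). Put a =
m₁, b = m₂, k = m₃ = m₄. Being logarithmic means: f has exponents in [a, d], g has exponents in [0,
d - b], and f - g and (f + g)(-X) both vanish to order k at 1. The sum of these two polynomials
involves only the even part of f and the odd part of g; their difference only the odd part of f and
the even part of g. So the problem splits into two questions on polynomials with prescribed
exponents and a zero of order k at 1. In characteristic zero a nonzero one exists exactly when more
than k exponents are allowed (`lt_card_support_of_X_sub_one_pow_dvd`,
`exists_support_subset_X_sub_one_pow_dvd`).

Exponents add up to |m| (`det_ne_zero_and_sum_eq`). For |m| = 2e + 2, Δ = 2 therefore means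
exponents e and e + 2. In degree e the two parity classes contain 2k exponents together: k - 1 and k
+ 1 if a, b, e are all odd, and k each otherwise. For odd |m| both sides of the equivalence fail.

Freeness comes from Saito's criterion (`exists_basis_of_det_eq`), applied to a pair of minimal
degree d₁ and a pair of degree |m| - d₁ independent of it, found by counting dimensions. -/

namespace Polynomial

variable {K : Type*} [Field K]

/-! ### Sparse polynomials with a zero of high order at 1 -/

/-- In characteristic zero, a nonzero polynomial vanishing to order `k` at `1` has more than `k`
terms. -/
theorem lt_card_support_of_X_sub_one_pow_dvd [CharZero K] (k : ℕ) :
    ∀ h : K[X], h ≠ 0 → (X - 1) ^ k ∣ h → k < h.support.card := by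
  induction k with
  | zero =>
    intro h h0 _
    exact Finset.card_pos.2 (nonempty_support_iff.2 h0)
  | succ k ih =>
    intro h h0 hd
    -- Removing the power of X keeps the number of terms and the order at 1, and makes the constant
    -- term nonzero. Differentiating then loses at least one term and at most one order of
    -- vanishing.
    obtain ⟨r, hr, hnd⟩ := exists_eq_pow_rootMultiplicity_mul_and_not_dvd h h0 0
    rw [C_0, sub_zero] at hr hnd
    set n := rootMultiplicity 0 h
    have hr0 : r ≠ 0 := by
      rintro rfl
      exact hnd (dvd_zero _)
    have hrc : r.coeff 0 ≠ 0 := fun hc => hnd (X_dvd_iff.2 hc)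
    have hcard : h.support.card = r.support.card := by
      rw [← Finset.card_map (s := r.support) (addRightEmbedding n), hr, mul_comm]
      congr 1
      ext i
      simp only [mem_support_iff, coeff_mul_X_pow', Finset.mem_map, addRightEmbedding_apply]
      constructor
      · intro hi
        split_ifs at hi with hle
        · exact ⟨i - n, hi, by omega⟩
        · exact absurd rfl hi
      · rintro ⟨j, hj, rfl⟩
        simpa using hj
    have hcop : IsCoprime ((X - 1 : K[X]) ^ (k + 1)) (X ^ n) := by
      apply IsCoprime.pow
      exact ⟨-1, 1, by ring⟩
    have hdr : (X - 1) ^ (k + 1) ∣ r := hcop.dvd_of_dvd_mul_left (hr ▸ hd)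
    have hder : (X - 1) ^ k ∣ derivative r := by
      obtain ⟨s, rfl⟩ := hdr
      rw [derivative_mul, derivative_pow_succ]
      refine dvd_add (Dvd.intro_left (C ((k : K) + 1) * derivative (X - 1) * s) ?_)
        (Dvd.intro (((X - 1) * derivative s)) ?_)
      · ring
      · ring
    have hder0 : derivative r ≠ 0 := by
      intro hz
      have hC := eq_C_of_derivative_eq_zero hz
      rw [hC] at hdr
      have he := eval_dvd (x := (1 : K)) hdr
      simp at he
      exact hrc he
    have hlt := ih _ hder0 hder
    have hsub : (derivative r).support.card ≤ (r.support.erase 0).card := by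
      rw [← Finset.card_map (addRightEmbedding 1)]
      apply Finset.card_le_card
      intro i hi
      simp only [Finset.mem_map, mem_support_iff, coeff_derivative, addRightEmbedding_apply] at hi
      obtain ⟨j, hj, rfl⟩ := hi
      simp only [Finset.mem_erase, mem_support_iff]
      exact ⟨by omega, left_ne_zero_of_mul hj⟩
    rw [Finset.card_erase_of_mem (mem_support_iff.2 hrc)] at hsub
    omega

/-- If a finite set `s` of exponents has more than `k` elements, some nonzero polynomial with
exponents in `s` vanishes to order `k` at `1`. -/
theorem exists_support_subset_X_sub_one_pow_dvd (s : Finset ℕ) (k : ℕ) (hk : k < s.card) :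
    ∃ h : K[X], h ≠ 0 ∧ h.support ⊆ s ∧ (X - 1) ^ k ∣ h := by
  let E : (s → K) →ₗ[K] K[X] := ∑ i : s, (monomial (i : ℕ)) ∘ₗ LinearMap.proj i
  have hE : ∀ c (i : s), (E c).coeff i = c i := by
    intro c i
    simp [E, coeff_monomial]
  have hE' : ∀ c, (E c).support ⊆ s := by
    intro c i hi
    by_contra his
    rw [mem_support_iff] at hi
    apply hi
    simp only [E, LinearMap.sum_apply, LinearMap.comp_apply, LinearMap.proj_apply, finsetSum_coeff,
      coeff_monomial]
    apply Finset.sum_eq_zero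
    intro j _
    rw [if_neg]
    rintro rfl
    exact his j.2
  -- The first k Taylor coefficients at 1: k linear equations in more than k unknowns.
  let T : (s → K) →ₗ[K] (Fin k → K) := LinearMap.pi fun j => lcoeff K j ∘ₗ taylor 1 ∘ₗ E
  have hker : LinearMap.ker T ≠ ⊥ := LinearMap.ker_ne_bot_of_finrank_lt (by simpa using hk)
  obtain ⟨c, hc, hc0⟩ := (Submodule.ne_bot_iff _).1 hker
  refine ⟨E c, ?_, hE' c, ?_⟩
  · intro h0
    apply hc0
    ext i
    rw [← hE c i, h0]
    simp
  · have : (X - 1 : K[X]) = X - C 1 := by simp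
    rw [this, X_sub_C_pow_dvd_iff, X_pow_dvd_iff]
    intro j hj
    exact congrFun (LinearMap.mem_ker.1 hc) ⟨j, hj⟩

/-! ### Affine logarithmic pairs: dimension count and pairs of minimal degree -/

theorem natDegree_lt_of_mem_degreeLT {n : ℕ} {f : K[X]} (h : f ∈ degreeLT K (n + 1)) :
    f.natDegree < n + 1 := by
  rcases eq_or_ne f 0 with h0 | h0
  · simp [h0]
  · exact (natDegree_lt_iff_degree_lt h0).2 (mem_degreeLT.1 h)

/-- The pairs `(f, g)` obtained by setting `y = 1` in the coefficients of the derivations of degree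
`d` that are logarithmic for `x ^ a * y ^ b * (x - y) ^ p * (x + y) ^ q`. -/
structure IsAffineLogPair (a b p q d : ℕ) (f g : K[X]) : Prop where
  X_pow_dvd : X ^ a ∣ f
  natDegree_le : natDegree f ≤ d
  -- Divisibility by y ^ b becomes a degree bound at y = 1. The guard is needed because `natDegree 0
  -- = 0` would force b ≤ d.
  natDegree_add_le : g ≠ 0 → natDegree g + b ≤ d
  dvd_sub : (X - 1) ^ p ∣ f - g
  dvd_add : (X + 1) ^ q ∣ f + g

/-- There are more affine logarithmic pairs than multiples of a given pair, once the degree is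
large. -/
theorem exists_isAffineLogPair_ne_mul (a b p q d r : ℕ) (f₁ g₁ : K[X])
    (hr : r + (a + b + p + q) < 2 * (d + 1)) :
    ∃ f g : K[X], IsAffineLogPair a b p q d f g ∧
      ∀ w : K[X], w.degree < r → ¬ (f = w * f₁ ∧ g = w * g₁) := by
  by_contra hcon
  push Not at hcon
  let F : (degreeLT K (d + 1) × degreeLT K (d + 1)) →ₗ[K] K[X] :=
    (degreeLT K (d + 1)).subtype ∘ₗ LinearMap.fst K _ _
  let G : (degreeLT K (d + 1) × degreeLT K (d + 1)) →ₗ[K] K[X] :=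
    (degreeLT K (d + 1)).subtype ∘ₗ LinearMap.snd K _ _
  -- The 2(d + 1) coefficients satisfy a + b + p + q linear equations, so the kernel has dimension
  -- greater than r, while the multiples in the range of `N` span at most r dimensions.
  let T : (degreeLT K (d + 1) × degreeLT K (d + 1)) →ₗ[K]
      ((Fin a → K) × (Fin b → K)) × ((Fin p → K) × (Fin q → K)) :=
    ((LinearMap.pi fun j : Fin a => lcoeff K j ∘ₗ F).prod
      (LinearMap.pi fun j : Fin b => lcoeff K (d - j) ∘ₗ G)).prod
    ((LinearMap.pi fun j : Fin p => lcoeff K j ∘ₗ taylor 1 ∘ₗ (F - G)).prod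
      (LinearMap.pi fun j : Fin q => lcoeff K j ∘ₗ taylor (-1) ∘ₗ (F + G)))
  let N : degreeLT K r →ₗ[K] K[X] × K[X] :=
    ((LinearMap.mulRight K f₁) ∘ₗ (degreeLT K r).subtype).prod
      ((LinearMap.mulRight K g₁) ∘ₗ (degreeLT K r).subtype)
  have hle : (LinearMap.ker T).map (F.prod G) ≤ LinearMap.range N := by
    rintro _ ⟨v, hv, rfl⟩
    have hv' : T v = 0 := hv
    have h1 : ∀ j : Fin a, (F v).coeff j = 0 := fun j => congrFun (congrArg (·.1.1) hv') j
    have h2 : ∀ j : Fin b, (G v).coeff (d - j) = 0 := fun j => congrFun (congrArg (·.1.2) hv') j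
    have h3 : ∀ j : Fin p, (taylor 1 (F v - G v)).coeff j = 0 :=
      fun j => congrFun (congrArg (·.2.1) hv') j
    have h4 : ∀ j : Fin q, (taylor (-1) (F v + G v)).coeff j = 0 :=
      fun j => congrFun (congrArg (·.2.2) hv') j
    have hF : (F v).natDegree < d + 1 := by
      exact natDegree_lt_of_mem_degreeLT v.1.2
    have hG : (G v).natDegree < d + 1 := by
      exact natDegree_lt_of_mem_degreeLT v.2.2
    obtain ⟨w, hw, hf, hg⟩ := hcon (F v) (G v)
      { X_pow_dvd := X_pow_dvd_iff.2 fun j hj => h1 ⟨j, hj⟩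
        natDegree_le := by omega
        natDegree_add_le := by
          intro hne
          by_contra hlt
          have := h2 ⟨d - (G v).natDegree, by omega⟩
          apply hne
          rw [← leadingCoeff_eq_zero, leadingCoeff]
          convert this using 2
          simp only
          omega
        dvd_sub := by
          rw [show (X - 1 : K[X]) = X - C 1 by simp, X_sub_C_pow_dvd_iff, X_pow_dvd_iff]
          exact fun j hj => h3 ⟨j, hj⟩
        dvd_add := by
          rw [show (X + 1 : K[X]) = X - C (-1) by simp, X_sub_C_pow_dvd_iff, X_pow_dvd_iff]
          exact fun j hj => h4 ⟨j, hj⟩ }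
    exact ⟨⟨w, mem_degreeLT.2 hw⟩, Prod.ext hf.symm hg.symm⟩
  have hinj : Function.Injective (F.prod G) := by
    intro u v huv
    exact Prod.ext (Subtype.ext (congrArg Prod.fst huv)) (Subtype.ext (congrArg Prod.snd huv))
  have hdim : ∀ n, Module.finrank K (degreeLT K n) = n := fun n => by
    rw [(degreeLTEquiv K n).finrank_eq, Module.finrank_fin_fun]
  have hfin : ∀ n, FiniteDimensional K (degreeLT K n) := fun n =>
    LinearEquiv.finiteDimensional (degreeLTEquiv K n).symm
  have e1 := Submodule.finrank_mono hle
  rw [LinearEquiv.finrank_eq (Submodule.equivMapOfInjective _ hinj _).symm] at e1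
  have e2 := LinearMap.finrank_range_le N
  have e3 := LinearMap.finrank_range_add_finrank_ker T
  have e4 := Submodule.finrank_le (LinearMap.range T)
  simp only [Module.finrank_prod, Module.finrank_fin_fun, hdim] at e2 e3 e4
  omega

/-- A pair parallel to an affine logarithmic pair of minimal degree is a multiple of it. -/
theorem IsAffineLogPair.exists_eq_mul {a b p q d₁ d₂ : ℕ} {f₁ g₁ f₂ g₂ : K[X]}
    (h₁ : IsAffineLogPair a b p q d₁ f₁ g₁) (h₁0 : f₁ ≠ 0 ∨ g₁ ≠ 0)
    (hmin : ∀ d < d₁, ∀ f g : K[X], IsAffineLogPair a b p q d f g → f = 0 ∧ g = 0)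
    (h₂ : IsAffineLogPair a b p q d₂ f₂ g₂) (hle : d₁ ≤ d₂) (hpar : f₁ * g₂ = f₂ * g₁) :
    ∃ w : K[X], w.degree < (d₂ - d₁ + 1 : ℕ) ∧ f₂ = w * f₁ ∧ g₂ = w * g₁ := by
  classical
  -- Both pairs are multiples c₁(φ, ψ) and c₂(φ, ψ) of one coprime pair. With c = gcd(c₁, c₂),
  -- Bézout makes c(φ, ψ) a combination of the two pairs, hence logarithmic, and minimality of d₁
  -- forces c₁ to be c up to a unit.
  obtain ⟨φ, ψ, u, v, c₁, huv, hf₁, hg₁⟩ : ∃ φ ψ u v c₁ : K[X],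
      u * φ + v * ψ = 1 ∧ f₁ = c₁ * φ ∧ g₁ = c₁ * ψ := by
    obtain ⟨φ, hφ⟩ := EuclideanDomain.gcd_dvd_left f₁ g₁
    obtain ⟨ψ, hψ⟩ := EuclideanDomain.gcd_dvd_right f₁ g₁
    have hb := EuclideanDomain.gcd_eq_gcd_ab f₁ g₁
    set h := EuclideanDomain.gcd f₁ g₁
    have hh : h ≠ 0 := by
      rintro h0
      rw [h0, zero_mul] at hφ hψ
      exact h₁0.elim (· hφ) (· hψ)
    refine ⟨φ, ψ, EuclideanDomain.gcdA f₁ g₁, EuclideanDomain.gcdB f₁ g₁, h, ?_, hφ, hψ⟩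
    apply mul_left_cancel₀ hh
    linear_combination (-1 : K[X]) * hb - EuclideanDomain.gcdA f₁ g₁ * hφ -
      EuclideanDomain.gcdB f₁ g₁ * hψ
  have hc₁ : c₁ ≠ 0 := by
    rintro rfl
    rw [zero_mul] at hf₁ hg₁
    exact h₁0.elim (· hf₁) (· hg₁)
  have hpar' : φ * g₂ = f₂ * ψ := by
    apply mul_left_cancel₀ hc₁
    rw [hf₁, hg₁] at hpar
    linear_combination hpar
  obtain ⟨c₂, hf₂, hg₂⟩ : ∃ c₂ : K[X], f₂ = c₂ * φ ∧ g₂ = c₂ * ψ :=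
    ⟨u * f₂ + v * g₂, by linear_combination (-f₂) * huv - v * hpar',
      by linear_combination (-g₂) * huv + u * hpar'⟩
  have hb := EuclideanDomain.gcd_eq_gcd_ab c₁ c₂
  obtain ⟨w₁, hw₁⟩ := EuclideanDomain.gcd_dvd_left c₁ c₂
  obtain ⟨w₂, hw₂⟩ := EuclideanDomain.gcd_dvd_right c₁ c₂
  set c := EuclideanDomain.gcd c₁ c₂
  set s := EuclideanDomain.gcdA c₁ c₂
  set t := EuclideanDomain.gcdB c₁ c₂
  have hw₁0 : w₁ ≠ 0 := by
    rintro rfl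
    exact hc₁ (by rw [hw₁, mul_zero])
  have hcφ : c * φ = s * f₁ + t * f₂ := by rw [hb, hf₁, hf₂]; ring
  have hcψ : c * ψ = s * g₁ + t * g₂ := by rw [hb, hg₁, hg₂]; ring
  have hf₁' : f₁ = w₁ * (c * φ) := by rw [hf₁, hw₁]; ring
  have hg₁' : g₁ = w₁ * (c * ψ) := by rw [hg₁, hw₁]; ring
  have hcpair : IsAffineLogPair a b p q (d₁ - w₁.natDegree) (c * φ) (c * ψ) :=
    { X_pow_dvd := by
        rw [hcφ]
        exact _root_.dvd_add (h₁.X_pow_dvd.mul_left _) (h₂.X_pow_dvd.mul_left _)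
      natDegree_le := by
        rcases eq_or_ne (c * φ) 0 with h0 | h0
        · simp [h0]
        · have := h₁.natDegree_le
          rw [hf₁', natDegree_mul hw₁0 h0] at this
          omega
      natDegree_add_le := by
        intro h0
        have := h₁.natDegree_add_le (hg₁' ▸ mul_ne_zero hw₁0 h0)
        rw [hg₁', natDegree_mul hw₁0 h0] at this
        omega
      dvd_sub := by
        rw [hcφ, hcψ, show s * f₁ + t * f₂ - (s * g₁ + t * g₂) =
          s * (f₁ - g₁) + t * (f₂ - g₂) by ring]
        exact _root_.dvd_add (h₁.dvd_sub.mul_left _) (h₂.dvd_sub.mul_left _)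
      dvd_add := by
        rw [hcφ, hcψ, show s * f₁ + t * f₂ + (s * g₁ + t * g₂) =
          s * (f₁ + g₁) + t * (f₂ + g₂) by ring]
        exact _root_.dvd_add (h₁.dvd_add.mul_left _) (h₂.dvd_add.mul_left _) }
  have hdeg : w₁.natDegree = 0 := by
    by_contra hpos
    have hz : ¬ (c * φ = 0 ∧ c * ψ = 0) := by
      rintro ⟨h1, h2⟩
      rw [h1, mul_zero] at hf₁'
      rw [h2, mul_zero] at hg₁'
      exact h₁0.elim (· hf₁') (· hg₁')
    -- For d₁ = 0 the truncated subtraction gives no smaller degree, so minimality says nothing; the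
    -- degree bounds contradict `hpos` directly.
    rcases Nat.eq_zero_or_pos d₁ with hd | hd
    · apply hz
      constructor
      · by_contra h0
        have := h₁.natDegree_le
        rw [hf₁', natDegree_mul hw₁0 h0] at this
        omega
      · by_contra h0
        have := h₁.natDegree_add_le (hg₁' ▸ mul_ne_zero hw₁0 h0)
        rw [hg₁', natDegree_mul hw₁0 h0] at this
        omega
    · exact hz (hmin _ (by omega) _ _ hcpair)
  obtain ⟨κ, hκ⟩ := natDegree_eq_zero.1 hdeg
  have hκ0 : κ ≠ 0 := by
    rintro rfl
    exact hw₁0 (by rw [← hκ, C_0])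
  have hκ1 : C κ⁻¹ * w₁ = 1 := by rw [← hκ, ← C_mul, inv_mul_cancel₀ hκ0, C_1]
  have hwf : f₂ = C κ⁻¹ * w₂ * f₁ := by
    rw [hf₂, hw₂, hf₁']
    linear_combination (-(c * w₂ * φ)) * hκ1
  have hwg : g₂ = C κ⁻¹ * w₂ * g₁ := by
    rw [hg₂, hw₂, hg₁']
    linear_combination (-(c * w₂ * ψ)) * hκ1
  refine ⟨C κ⁻¹ * w₂, ?_, hwf, hwg⟩
  set w := C κ⁻¹ * w₂
  rcases eq_or_ne w 0 with hw | hw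
  · rw [hw, degree_zero]
    exact WithBot.bot_lt_coe _
  rw [degree_eq_natDegree hw, Nat.cast_lt]
  by_contra hlt
  have hz : ¬ (f₁ = 0 ∧ g₁ = 0) := fun h => h₁0.elim (· h.1) (· h.2)
  have key1 : f₁ ≠ 0 → f₁.natDegree < d₁ := by
    intro h0
    have := h₂.natDegree_le
    rw [hwf, natDegree_mul hw h0] at this
    omega
  have key2 : g₁ ≠ 0 → g₁.natDegree + b < d₁ := by
    intro h0
    have := h₂.natDegree_add_le (hwg ▸ mul_ne_zero hw h0)
    rw [hwg, natDegree_mul hw h0] at this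
    omega
  have hd : 0 < d₁ := by
    rcases h₁0 with h0 | h0
    · exact (Nat.zero_le _).trans_lt (key1 h0)
    · exact (Nat.zero_le _).trans_lt (key2 h0)
  -- If w had too large a degree, the first pair would already satisfy the bounds for d₁ - 1;
  -- homogeneously, it would be divisible by y.
  refine hz (hmin (d₁ - 1) (by omega) f₁ g₁ ⟨h₁.X_pow_dvd, ?_, ?_, h₁.dvd_sub, h₁.dvd_add⟩)
  · rcases eq_or_ne f₁ 0 with h0 | h0
    · simp [h0]
    · exact Nat.le_sub_one_of_lt (key1 h0)
  · exact fun h0 => Nat.le_sub_one_of_lt (key2 h0)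

/-! ### Reflection X ↦ -X and splitting by parity -/

theorem coeff_comp_neg_X (f : K[X]) (i : ℕ) : (f.comp (-X)).coeff i = (-1) ^ i * f.coeff i := by
  rw [show (-X : K[X]) = C (-1) * X by simp, comp_C_mul_X_coeff, mul_comm]

theorem X_sub_one_pow_dvd_comp_neg_X {f : K[X]} {k : ℕ} (h : (X + 1) ^ k ∣ f) :
    (X - 1) ^ k ∣ f.comp (-X) := by
  obtain ⟨r, rfl⟩ := h
  have hX : (X + 1 : K[X]).comp (-X) = -1 * (X - 1) := by
    simp
    ring
  refine ⟨(-1) ^ k * r.comp (-X), ?_⟩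
  rw [mul_comp, pow_comp, hX, mul_pow]
  ring

theorem X_add_one_pow_dvd_comp_neg_X {f : K[X]} {k : ℕ} (h : (X - 1) ^ k ∣ f) :
    (X + 1) ^ k ∣ f.comp (-X) := by
  obtain ⟨r, rfl⟩ := h
  have hX : (X - 1 : K[X]).comp (-X) = -1 * (X + 1) := by
    simp
    ring
  refine ⟨(-1) ^ k * r.comp (-X), ?_⟩
  rw [mul_comp, pow_comp, hX, mul_pow]
  ring

variable [CharZero K]

theorem eq_zero_of_support_subset {h : K[X]} {s : Finset ℕ} {k : ℕ} (hs : h.support ⊆ s)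
    (hk : s.card ≤ k) (hd : (X - 1) ^ k ∣ h) : h = 0 := by
  by_contra h0
  have h1 := lt_card_support_of_X_sub_one_pow_dvd k h h0 hd
  have h2 := Finset.card_le_card hs
  omega

/-- If neither parity class has more than `k` admissible exponents, there is no nonzero affine
logarithmic pair. -/
theorem IsAffineLogPair.eq_zero {a b k d : ℕ} {f g : K[X]} (h : IsAffineLogPair a b k k d f g)
    (hE : (d / 2 + 1 - (a + 1) / 2) + (d + 1 - b) / 2 ≤ k)
    (hO : ((d + 1) / 2 - a / 2) + (d + 2 - b) / 2 ≤ k) : f = 0 ∧ g = 0 := by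
  have hf : ∀ i, f.coeff i ≠ 0 → a ≤ i ∧ i ≤ d := by
    intro i hi
    refine ⟨?_, (le_natDegree_of_ne_zero hi).trans h.natDegree_le⟩
    by_contra hlt
    exact hi (X_pow_dvd_iff.1 h.X_pow_dvd i (by omega))
  have hg : ∀ i, g.coeff i ≠ 0 → i + b ≤ d := by
    intro i hi
    have h0 : g ≠ 0 := by
      rintro rfl
      exact hi rfl
    have := le_natDegree_of_ne_zero hi
    have := h.natDegree_add_le h0
    omega
  have hdvd := X_sub_one_pow_dvd_comp_neg_X h.dvd_add
  -- The two combinations separate the parity classes and together determine f and g.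
  have hcP : ∀ i, ((f - g) + (f + g).comp (-X)).coeff i =
      if Even i then 2 * f.coeff i else -2 * g.coeff i := by
    intro i
    rw [coeff_add, coeff_comp_neg_X, coeff_sub, coeff_add]
    split_ifs with hi
    · rw [hi.neg_one_pow]; ring
    · rw [(Nat.not_even_iff_odd.1 hi).neg_one_pow]; ring
  have hcQ : ∀ i, ((f - g) - (f + g).comp (-X)).coeff i =
      if Even i then -2 * g.coeff i else 2 * f.coeff i := by
    intro i
    rw [coeff_sub, coeff_comp_neg_X, coeff_sub, coeff_add]
    split_ifs with hi
    · rw [hi.neg_one_pow]; ring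
    · rw [(Nat.not_even_iff_odd.1 hi).neg_one_pow]; ring
  have hP : (f - g) + (f + g).comp (-X) = 0 := by
    refine eq_zero_of_support_subset
      (s := (Finset.Ico ((a + 1) / 2) (d / 2 + 1)).image (fun i => 2 * i) ∪
        (Finset.range ((d + 1 - b) / 2)).image (fun i => 2 * i + 1)) ?_ ?_
      (_root_.dvd_add h.dvd_sub hdvd)
    · intro i hi
      rw [mem_support_iff, hcP] at hi
      simp only [Finset.mem_union, Finset.mem_image, Finset.mem_Ico, Finset.mem_range]
      split_ifs at hi with he
      · obtain ⟨j, rfl⟩ := he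
        have := hf _ (right_ne_zero_of_mul hi)
        exact Or.inl ⟨j, by omega, by omega⟩
      · obtain ⟨j, rfl⟩ := Nat.not_even_iff_odd.1 he
        have := hg _ (right_ne_zero_of_mul hi)
        exact Or.inr ⟨j, by omega, by omega⟩
    · refine (Finset.card_union_le _ _).trans ((add_le_add Finset.card_image_le
        Finset.card_image_le).trans ?_)
      simpa using hE
  have hQ : (f - g) - (f + g).comp (-X) = 0 := by
    refine eq_zero_of_support_subset
      (s := (Finset.Ico (a / 2) ((d + 1) / 2)).image (fun i => 2 * i + 1) ∪
        (Finset.range ((d + 2 - b) / 2)).image (fun i => 2 * i)) ?_ ?_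
      (_root_.dvd_sub h.dvd_sub hdvd)
    · intro i hi
      rw [mem_support_iff, hcQ] at hi
      simp only [Finset.mem_union, Finset.mem_image, Finset.mem_Ico, Finset.mem_range]
      split_ifs at hi with he
      · obtain ⟨j, rfl⟩ := he
        have := hg _ (right_ne_zero_of_mul hi)
        exact Or.inr ⟨j, by omega, by omega⟩
      · obtain ⟨j, rfl⟩ := Nat.not_even_iff_odd.1 he
        have := hf _ (right_ne_zero_of_mul hi)
        exact Or.inl ⟨j, by omega, by omega⟩
    · refine (Finset.card_union_le _ _).trans ((add_le_add Finset.card_image_le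
        Finset.card_image_le).trans ?_)
      simpa using hO
  have h2 : (2 : K) ≠ 0 := two_ne_zero
  constructor
  · ext i
    have e1 := hcP i
    have e2 := hcQ i
    rw [hP, coeff_zero] at e1
    rw [hQ, coeff_zero] at e2
    split_ifs at e1 e2 <;> simp_all
  · ext i
    have e1 := hcP i
    have e2 := hcQ i
    rw [hP, coeff_zero] at e1
    rw [hQ, coeff_zero] at e2
    split_ifs at e1 e2 <;> simp_all

/-- A nonzero affine logarithmic pair with `f` odd and `g` even exists if these parities leave more
than `k` admissible exponents. -/
theorem exists_isAffineLogPair_of_lt {a b k d : ℕ}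
    (hk : k < ((d + 1) / 2 - a / 2) + (d + 2 - b) / 2) :
    ∃ f g : K[X], IsAffineLogPair a b k k d f g ∧ (f ≠ 0 ∨ g ≠ 0) := by
  obtain ⟨h, h0, hs, hd⟩ := exists_support_subset_X_sub_one_pow_dvd (K := K)
    ((Finset.Ico (a / 2) ((d + 1) / 2)).image (fun i => 2 * i + 1) ∪
        (Finset.range ((d + 2 - b) / 2)).image (fun i => 2 * i)) k (by
      rw [Finset.card_union_of_disjoint, Finset.card_image_of_injective,
        Finset.card_image_of_injective]
      · simpa using hk
      · intro i j hij
        simpa using hij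
      · intro i j hij
        simpa using hij
      · rw [Finset.disjoint_left]
        simp only [Finset.mem_image, not_exists, not_and]
        rintro _ ⟨i, _, rfl⟩ j _
        omega)
  have hh : ∀ i, h.coeff i ≠ 0 →
      (Odd i ∧ a ≤ i ∧ i ≤ d) ∨ (Even i ∧ i + b ≤ d) := by
    intro i hi
    have := hs (mem_support_iff.2 hi)
    simp only [Finset.mem_union, Finset.mem_image, Finset.mem_Ico, Finset.mem_range] at this
    rcases this with ⟨j, hj, rfl⟩ | ⟨j, hj, rfl⟩
    · exact Or.inl ⟨odd_two_mul_add_one j, by omega, by omega⟩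
    · exact Or.inr ⟨even_two_mul j, by omega⟩
  have hF : ∀ i, (h - h.comp (-X)).coeff i ≠ 0 → a ≤ i ∧ i ≤ d := by
    intro i hi
    rw [coeff_sub, coeff_comp_neg_X] at hi
    rcases Nat.even_or_odd i with he | ho
    · rw [he.neg_one_pow, one_mul, sub_self] at hi
      exact absurd rfl hi
    · rcases hh i (fun h => hi (by rw [h]; simp)) with h1 | h1
      · exact h1.2
      · exact absurd h1.1 (Nat.not_even_iff_odd.2 ho)
  have hG : ∀ i, (-(h + h.comp (-X))).coeff i ≠ 0 → i + b ≤ d := by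
    intro i hi
    rw [coeff_neg, coeff_add, coeff_comp_neg_X] at hi
    rcases Nat.even_or_odd i with he | ho
    · rcases hh i (fun h => hi (by rw [h]; simp)) with h1 | h1
      · exact absurd he (Nat.not_even_iff_odd.2 h1.1)
      · exact h1.2
    · rw [ho.neg_one_pow] at hi
      simp at hi
  -- Twice the odd part of h, and minus twice its even part, so that f - g = 2h and f + g = -2h(-X).
  refine ⟨h - h.comp (-X), -(h + h.comp (-X)), ⟨?_, ?_, ?_, ?_, ?_⟩, ?_⟩
  · rw [X_pow_dvd_iff]
    intro i hi
    by_contra hc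
    have := hF i hc
    omega
  · rw [natDegree_le_iff_coeff_eq_zero]
    intro i hi
    by_contra hc
    have := hF i hc
    omega
  · intro hne
    exact hG _ (leadingCoeff_ne_zero.2 hne)
  · rw [show h - h.comp (-X) - -(h + h.comp (-X)) = 2 * h by ring]
    exact hd.mul_left _
  · rw [show h - h.comp (-X) + -(h + h.comp (-X)) = (-2) * h.comp (-X) by ring]
    exact (X_add_one_pow_dvd_comp_neg_X hd).mul_left _
  · by_contra hc
    push Not at hc
    have : 2 * h = 0 := by linear_combination hc.1 - hc.2
    exact h0 ((mul_eq_zero.1 this).resolve_left two_ne_zero)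

end Polynomial

/-! ### Logarithmic pairs in two variables and Saito's criterion -/

section LogPairs

variable {K : Type*} [Field K]

/-- The coefficient pairs of the derivations that are logarithmic for
`x ^ a * y ^ b * (x - y) ^ p * (x + y) ^ q`. -/
structure IsLogPair (a b p q : ℕ) (F G : MvPolynomial (Fin 2) K) : Prop where
  dvd_left : X 0 ^ a ∣ F
  dvd_right : X 1 ^ b ∣ G
  dvd_sub : (X 0 - X 1) ^ p ∣ F - G
  dvd_add : (X 0 + X 1) ^ q ∣ F + G

/-- The defining polynomial of the multiarrangement. -/
noncomputable def definingPolyB2 (K : Type*) [Field K] (a b p q : ℕ) : MvPolynomial (Fin 2) K :=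
  X 0 ^ a * X 1 ^ b * (X 0 - X 1) ^ p * (X 0 + X 1) ^ q

theorem mem_logDerivations_formsB2_iff {a b p q : ℕ}
    {θ : Derivation K (MvPolynomial (Fin 2) K) (MvPolynomial (Fin 2) K)} :
    θ ∈ logDerivations (formsB2 K) ![a, b, p, q] ↔ IsLogPair a b p q (θ (X 0)) (θ (X 1)) := by
  change (∀ i, _) ↔ _
  simp only [Fin.forall_fin_succ, Ideal.mem_span_singleton, formsB2]
  constructor
  · rintro ⟨h1, h2, h3, h4, -⟩
    refine ⟨h1, h2, ?_, ?_⟩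
    · rw [← map_sub]; exact h3
    · rw [← map_add]; exact h4
  · rintro ⟨h1, h2, h3, h4⟩
    rw [← map_sub] at h3
    rw [← map_add] at h4
    exact ⟨h1, h2, h3, h4, fun i => i.elim0⟩

theorem isHomogeneous_X_sub_X :
    (X 0 - X 1 : MvPolynomial (Fin 2) K).IsHomogeneous 1 :=
  (isHomogeneous_X K 0).sub (isHomogeneous_X K 1)

theorem isHomogeneous_X_add_X :
    (X 0 + X 1 : MvPolynomial (Fin 2) K).IsHomogeneous 1 :=
  (isHomogeneous_X K 0).add (isHomogeneous_X K 1)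

theorem isHomogeneous_definingPolyB2 (a b p q : ℕ) :
    (definingPolyB2 K a b p q).IsHomogeneous (a + b + p + q) := by
  have h := ((((isHomogeneous_X K (0 : Fin 2)).pow a).mul
    ((isHomogeneous_X K (1 : Fin 2)).pow b)).mul
    ((isHomogeneous_X_sub_X (K := K)).pow p)).mul ((isHomogeneous_X_add_X (K := K)).pow q)
  simpa only [one_mul, definingPolyB2] using h

theorem definingPolyB2_ne_zero (a b p q : ℕ) : definingPolyB2 K a b p q ≠ 0 := by
  have h1 : (X 0 - X 1 : MvPolynomial (Fin 2) K) ≠ 0 := by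
    intro h
    simpa using congrArg (eval (![1, 0] : Fin 2 → K)) h
  have h2 : (X 0 + X 1 : MvPolynomial (Fin 2) K) ≠ 0 := by
    intro h
    simpa using congrArg (eval (![1, 0] : Fin 2 → K)) h
  exact mul_ne_zero (mul_ne_zero (mul_ne_zero (pow_ne_zero _ (X_ne_zero _))
    (pow_ne_zero _ (X_ne_zero _))) (pow_ne_zero _ h1)) (pow_ne_zero _ h2)

theorem isRelPrime_X_zero_X_one : IsRelPrime (X 0 : MvPolynomial (Fin 2) K) (X 1) := by
  rw [(X_prime (R := K) (i := (0 : Fin 2))).irreducible.isRelPrime_iff_not_dvd, X_dvd_X]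
  decide

/-- Each prime power divides the determinant after a suitable row operation, and the four linear
forms are pairwise coprime; for x - y and x + y this needs 2 to be invertible. -/
theorem IsLogPair.definingPolyB2_dvd [CharZero K] {a b p q : ℕ}
    {F G F' G' : MvPolynomial (Fin 2) K} (h : IsLogPair a b p q F G)
    (h' : IsLogPair a b p q F' G') : definingPolyB2 K a b p q ∣ F * G' - F' * G := by
  have hc : (C 2⁻¹ : MvPolynomial (Fin 2) K) * 2 = 1 := by
    rw [show (2 : MvPolynomial (Fin 2) K) = C 2 from (map_ofNat C 2).symm, ← C_mul,
      inv_mul_cancel₀ two_ne_zero, C_1]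
  have key : ∀ {u v : MvPolynomial (Fin 2) K},
      (∀ t, t ∣ u → t ∣ v → t ∣ X 0 ∧ t ∣ X 1) → IsRelPrime u v := fun huv t h1 h2 =>
    isRelPrime_X_zero_X_one (huv t h1 h2).1 (huv t h1 h2).2
  have r1 : IsRelPrime (X 0 : MvPolynomial (Fin 2) K) (X 0 - X 1) := key fun t h1 h2 =>
    ⟨h1, by simpa using _root_.dvd_sub h1 h2⟩
  have r2 : IsRelPrime (X 1 : MvPolynomial (Fin 2) K) (X 0 - X 1) := key fun t h1 h2 =>
    ⟨by simpa using _root_.dvd_add h1 h2, h1⟩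
  have r3 : IsRelPrime (X 0 : MvPolynomial (Fin 2) K) (X 0 + X 1) := key fun t h1 h2 =>
    ⟨h1, by simpa using _root_.dvd_sub h2 h1⟩
  have r4 : IsRelPrime (X 1 : MvPolynomial (Fin 2) K) (X 0 + X 1) := key fun t h1 h2 =>
    ⟨by simpa using _root_.dvd_sub h2 h1, h1⟩
  have r5 : IsRelPrime (X 0 - X 1 : MvPolynomial (Fin 2) K) (X 0 + X 1) := key fun t h1 h2 => by
    constructor
    · have := (_root_.dvd_add h1 h2).mul_left (C 2⁻¹)
      rwa [show (C 2⁻¹ : MvPolynomial (Fin 2) K) * (X 0 - X 1 + (X 0 + X 1)) = X 0 by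
        linear_combination X 0 * hc] at this
    · have := (_root_.dvd_sub h2 h1).mul_left (C 2⁻¹)
      rwa [show (C 2⁻¹ : MvPolynomial (Fin 2) K) * (X 0 + X 1 - (X 0 - X 1)) = X 1 by
        linear_combination X 1 * hc] at this
  refine IsRelPrime.mul_dvd ((r3.pow.mul_left r4.pow).mul_left r5.pow)
    (IsRelPrime.mul_dvd (r1.pow.mul_left r2.pow)
      (IsRelPrime.mul_dvd isRelPrime_X_zero_X_one.pow ?_ ?_) ?_) ?_
  · exact _root_.dvd_sub (h.dvd_left.mul_right _) (h'.dvd_left.mul_right _)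
  · exact _root_.dvd_sub (h'.dvd_right.mul_left _) (h.dvd_right.mul_left _)
  · rw [show F * G' - F' * G = (F - G) * G' - (F' - G') * G by ring]
    exact _root_.dvd_sub (h.dvd_sub.mul_right _) (h'.dvd_sub.mul_right _)
  · rw [show F * G' - F' * G = (F + G) * G' - (F' + G') * G by ring]
    exact _root_.dvd_sub (h.dvd_add.mul_right _) (h'.dvd_add.mul_right _)

/-- Saito's criterion: two logarithmic derivations whose coefficient determinant is a nonzero
scalar multiple of the defining polynomial form a basis. -/
theorem exists_basis_of_det_eq [CharZero K] {a b p q : ℕ}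
    {θ₀ θ₁ : Derivation K (MvPolynomial (Fin 2) K) (MvPolynomial (Fin 2) K)}
    (h₀ : θ₀ ∈ logDerivations (formsB2 K) ![a, b, p, q])
    (h₁ : θ₁ ∈ logDerivations (formsB2 K) ![a, b, p, q]) {c : K} (hc : c ≠ 0)
    (hdet : θ₀ (X 0) * θ₁ (X 1) - θ₁ (X 0) * θ₀ (X 1) = C c * definingPolyB2 K a b p q) :
    ∃ B : Module.Basis (Fin 2) (MvPolynomial (Fin 2) K)
      (logDerivations (formsB2 K) ![a, b, p, q]), (B 0).1 = θ₀ ∧ (B 1).1 = θ₁ := by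
  set Q := definingPolyB2 K a b p q
  have hQ : Q ≠ 0 := definingPolyB2_ne_zero a b p q
  have hdet0 : θ₀ (X 0) * θ₁ (X 1) - θ₁ (X 0) * θ₀ (X 1) ≠ 0 := by
    rw [hdet]
    exact mul_ne_zero (by simpa using hc) hQ
  let v : Fin 2 → logDerivations (formsB2 K) ![a, b, p, q] := ![⟨θ₀, h₀⟩, ⟨θ₁, h₁⟩]
  have hli : LinearIndependent (MvPolynomial (Fin 2) K) v := by
    rw [Fintype.linearIndependent_iffₛ]
    intro g g' hg
    rw [Fin.sum_univ_two, Fin.sum_univ_two] at hg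
    rw [Fin.forall_fin_two]
    have e : g 0 • θ₀ + g 1 • θ₁ = g' 0 • θ₀ + g' 1 • θ₁ := congrArg Subtype.val hg
    have e0 : g 0 * θ₀ (X 0) + g 1 * θ₁ (X 0) = g' 0 * θ₀ (X 0) + g' 1 * θ₁ (X 0) :=
      congrArg (fun D => D (X 0)) e
    have e1 : g 0 * θ₀ (X 1) + g 1 * θ₁ (X 1) = g' 0 * θ₀ (X 1) + g' 1 * θ₁ (X 1) :=
      congrArg (fun D => D (X 1)) e
    constructor
    · apply mul_right_cancel₀ hdet0
      linear_combination θ₁ (X 1) * e0 - θ₁ (X 0) * e1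
    · apply mul_right_cancel₀ hdet0
      linear_combination θ₀ (X 0) * e1 - θ₀ (X 1) * e0
  have hsp : ⊤ ≤ Submodule.span (MvPolynomial (Fin 2) K) (Set.range v) := by
    rintro ⟨θ, hθ⟩ -
    have l := mem_logDerivations_formsB2_iff.1 hθ
    obtain ⟨u, hu⟩ := l.definingPolyB2_dvd (mem_logDerivations_formsB2_iff.1 h₁)
    obtain ⟨w, hw⟩ := (mem_logDerivations_formsB2_iff.1 h₀).definingPolyB2_dvd l
    have hcc : (C c⁻¹ : MvPolynomial (Fin 2) K) * C c = 1 := by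
      rw [← C_mul, inv_mul_cancel₀ hc, C_1]
    -- Cramer's rule; the quotients u and w exist because Q divides every determinant of two
    -- logarithmic pairs.
    have hθe : θ = (C c⁻¹ * u) • θ₀ + (C c⁻¹ * w) • θ₁ := by
      apply derivation_ext
      have hcomb : ∀ i, C c * Q * θ (X i) = Q * u * θ₀ (X i) + Q * w * θ₁ (X i) := by
        rw [← hdet, ← hu, ← hw, Fin.forall_fin_two]
        constructor <;> ring
      intro i
      apply mul_left_cancel₀ hQ
      rw [Derivation.add_apply, Derivation.smul_apply, Derivation.smul_apply, smul_eq_mul,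
        smul_eq_mul]
      linear_combination (-(Q * θ (X i))) * hcc + C c⁻¹ * hcomb i
    have : (⟨θ, hθ⟩ : logDerivations (formsB2 K) ![a, b, p, q]) =
        (C c⁻¹ * u) • v 0 + (C c⁻¹ * w) • v 1 := Subtype.ext hθe
    rw [this]
    exact Submodule.add_mem _ (Submodule.smul_mem _ _ (Submodule.subset_span ⟨0, rfl⟩))
      (Submodule.smul_mem _ _ (Submodule.subset_span ⟨1, rfl⟩))
  exact ⟨Module.Basis.mk hli hsp, by simp [v], by simp [v]⟩

/-! ### Passing between y = 1 and homogeneous polynomials -/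

section Dehomogenize

open Polynomial (homogenize)

theorem dvd_homogenize {L : MvPolynomial (Fin 2) K} {l h : Polynomial K} {n d : ℕ}
    (hL : L.IsHomogeneous n) (hl : aeval ![Polynomial.X, 1] L = l) (hn : l.natDegree = n)
    (hdvd : l ∣ h) (hd : h.natDegree ≤ d) : L ∣ h.homogenize d := by
  rcases eq_or_ne h 0 with rfl | h0
  · simp
  obtain ⟨r, rfl⟩ := hdvd
  rw [Polynomial.natDegree_mul (left_ne_zero_of_mul h0) (right_ne_zero_of_mul h0)] at hd
  rw [show d = n + (d - n) by omega, Polynomial.homogenize_mul l r hn.le (by omega),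
    Polynomial.homogenize_eq_of_isHomogeneous hL hl]
  exact Dvd.intro _ rfl

theorem natDegree_aeval_le {F : MvPolynomial (Fin 2) K} {d : ℕ} (hF : F.IsHomogeneous d) :
    (aeval ![Polynomial.X, 1] F : Polynomial K).natDegree ≤ d := by
  have := aeval_natDegree_le F hF.totalDegree_le (![Polynomial.X, 1] : Fin 2 → Polynomial K)
    (n := 1) (by simp [Fin.forall_fin_two])
  simpa using this

theorem aeval_eq_zero_iff {F : MvPolynomial (Fin 2) K} {d : ℕ} (hF : F.IsHomogeneous d) :
    (aeval ![Polynomial.X, 1] F : Polynomial K) = 0 ↔ F = 0 := by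
  constructor
  · intro h
    rw [← Polynomial.homogenize_eq_of_isHomogeneous hF h, Polynomial.homogenize_zero]
  · rintro rfl
    exact map_zero _

theorem IsLogPair.isAffineLogPair {a b p q d : ℕ} {F G : MvPolynomial (Fin 2) K}
    (h : IsLogPair a b p q F G) (hF : F.IsHomogeneous d) (hG : G.IsHomogeneous d) :
    Polynomial.IsAffineLogPair a b p q d (aeval ![(Polynomial.X : Polynomial K), 1] F)
      (aeval ![(Polynomial.X : Polynomial K), 1] G) where
  X_pow_dvd := by
    simpa using map_dvd (aeval (R := K) ![(Polynomial.X : Polynomial K), 1]) h.dvd_left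
  natDegree_le := natDegree_aeval_le hF
  natDegree_add_le := by
    intro h0
    by_contra hlt
    have hle := natDegree_aeval_le hG
    set g := (aeval ![Polynomial.X, 1] G : Polynomial K) with hg
    obtain ⟨R, hR⟩ := h.dvd_right
    have hGe := Polynomial.homogenize_eq_of_isHomogeneous hG hg.symm
    apply h0
    rw [← Polynomial.leadingCoeff_eq_zero, Polynomial.leadingCoeff]
    -- The leading coefficient of g is the coefficient in G of a monomial whose y-exponent d - deg g
    -- is below b, so it vanishes.
    have hco := Polynomial.coeff_homogenize g d
      (Finsupp.single 0 g.natDegree + Finsupp.single 1 (d - g.natDegree))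
    rw [hGe, hR, X_pow_eq_monomial, coeff_monomial_mul', if_neg, if_pos] at hco
    · simpa using hco.symm
    · simp
      omega
    · intro hs
      have := hs 1
      simp at this
      omega
  dvd_sub := by simpa using map_dvd (aeval (R := K) ![(Polynomial.X : Polynomial K), 1]) h.dvd_sub
  dvd_add := by simpa using map_dvd (aeval (R := K) ![(Polynomial.X : Polynomial K), 1]) h.dvd_add

end Dehomogenize

theorem Polynomial.IsAffineLogPair.isLogPair {a b p q d : ℕ} {f g : Polynomial K}
    (h : Polynomial.IsAffineLogPair a b p q d f g) :
    IsLogPair a b p q (f.homogenize d) (g.homogenize d) := by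
  have hgd : g.natDegree ≤ d := by
    rcases eq_or_ne g 0 with h0 | h0
    · simp [h0]
    · have := h.natDegree_add_le h0
      omega
  refine ⟨?_, ?_, ?_, ?_⟩
  · exact dvd_homogenize (isHomogeneous_X_pow 0 a) (by simp) (by simp) h.X_pow_dvd h.natDegree_le
  · rcases eq_or_ne g 0 with h0 | h0
    · simp [h0]
    · have := h.natDegree_add_le h0
      -- Homogenizing the factor 1 in degree b produces y ^ b.
      rw [← one_mul g, show d = b + (d - b) by omega,
        Polynomial.homogenize_mul 1 g (by simp) (by omega), Polynomial.homogenize_one]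
      exact Dvd.intro _ rfl
  · rw [← Polynomial.homogenize_sub]
    refine dvd_homogenize (by simpa using (isHomogeneous_X_sub_X (K := K)).pow p) (by simp) ?_
      h.dvd_sub ((Polynomial.natDegree_sub_le _ _).trans (max_le h.natDegree_le hgd))
    rw [Polynomial.natDegree_pow, ← Polynomial.C_1, Polynomial.natDegree_X_sub_C, mul_one]
  · rw [← Polynomial.homogenize_add]
    refine dvd_homogenize (by simpa using (isHomogeneous_X_add_X (K := K)).pow q) (by simp) ?_
      h.dvd_add ((Polynomial.natDegree_add_le _ _).trans (max_le h.natDegree_le hgd))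
    rw [Polynomial.natDegree_pow, ← Polynomial.C_1, Polynomial.natDegree_X_add_C, mul_one]

/-! ### Freeness -/

/-- Two homogeneous logarithmic pairs with determinant the defining polynomial, up to a scalar. -/
theorem exists_isLogPair_det_eq [CharZero K] (a b p q : ℕ) :
    ∃ d₁ d₂ : ℕ, ∃ F₁ G₁ F₂ G₂ : MvPolynomial (Fin 2) K,
      (F₁.IsHomogeneous d₁ ∧ G₁.IsHomogeneous d₁ ∧ IsLogPair a b p q F₁ G₁) ∧
      (F₂.IsHomogeneous d₂ ∧ G₂.IsHomogeneous d₂ ∧ IsLogPair a b p q F₂ G₂) ∧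
      ∃ c : K, c ≠ 0 ∧ F₁ * G₂ - F₂ * G₁ = C c * definingPolyB2 K a b p q := by
  classical
  have hex : ∀ d, a + b + p + q < 2 * (d + 1) → ∃ f g : Polynomial K,
      Polynomial.IsAffineLogPair a b p q d f g ∧ (f ≠ 0 ∨ g ≠ 0) := by
    intro d hd
    obtain ⟨f, g, hfg, hw⟩ :=
      Polynomial.exists_isAffineLogPair_ne_mul (K := K) a b p q d 0 0 0 (by omega)
    refine ⟨f, g, hfg, ?_⟩
    by_contra hc
    push Not at hc
    refine hw 0 ?_ ⟨by simp [hc.1], by simp [hc.2]⟩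
    rw [Polynomial.degree_zero]
    exact WithBot.bot_lt_coe _
  have hex' : ∃ d, ∃ f g : Polynomial K,
      Polynomial.IsAffineLogPair a b p q d f g ∧ (f ≠ 0 ∨ g ≠ 0) :=
    ⟨_, hex (a + b + p + q) (by omega)⟩
  obtain ⟨d₁, ⟨f₁, g₁, h₁, h₁0⟩, hmin⟩ : ∃ d₁, (∃ f g : Polynomial K,
      Polynomial.IsAffineLogPair a b p q d₁ f g ∧ (f ≠ 0 ∨ g ≠ 0)) ∧
      ∀ d < d₁, ¬ ∃ f g : Polynomial K,
        Polynomial.IsAffineLogPair a b p q d f g ∧ (f ≠ 0 ∨ g ≠ 0) :=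
    ⟨Nat.find hex', Nat.find_spec hex', fun d hd => Nat.find_min hex' hd⟩
  have hd₁ : 2 * d₁ ≤ a + b + p + q := by
    by_contra hlt
    exact hmin (d₁ - 1) (by omega) (hex _ (by omega))
  -- With this degree the determinant has the degree of Q, so the quotient `r` is a constant. The
  -- multiples of the first pair use d₂ - d₁ + 1 parameters, one fewer than the dimension count
  -- guarantees.
  set d₂ := a + b + p + q - d₁ with hd₂
  obtain ⟨f₂, g₂, h₂, hw⟩ :=
    Polynomial.exists_isAffineLogPair_ne_mul (K := K) a b p q d₂ (d₂ - d₁ + 1) f₁ g₁ (by omega)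
  have hmin' : ∀ d < d₁, ∀ f g : Polynomial K,
      Polynomial.IsAffineLogPair a b p q d f g → f = 0 ∧ g = 0 := by
    intro d hd f g hfg
    by_contra hc
    exact hmin d hd ⟨f, g, hfg, not_and_or.1 hc⟩
  have hdet : f₁ * g₂ - f₂ * g₁ ≠ 0 := by
    intro h0
    obtain ⟨w, hwd, hwe⟩ := h₁.exists_eq_mul h₁0 hmin' h₂ (by omega) (sub_eq_zero.1 h0)
    exact hw w hwd hwe
  have hdeg : ∀ {d : ℕ} {f g : Polynomial K}, Polynomial.IsAffineLogPair a b p q d f g →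
      g.natDegree ≤ d := by
    intro d f g h
    rcases eq_or_ne g 0 with h0 | h0
    · simp [h0]
    · have := h.natDegree_add_le h0
      omega
  refine ⟨d₁, d₂, f₁.homogenize d₁, g₁.homogenize d₁, f₂.homogenize d₂, g₂.homogenize d₂,
    ⟨by simp, by simp, h₁.isLogPair⟩, ⟨by simp, by simp, h₂.isLogPair⟩, ?_⟩
  obtain ⟨r, hr⟩ := h₁.isLogPair.definingPolyB2_dvd h₂.isLogPair
  have hD0 : f₁.homogenize d₁ * g₂.homogenize d₂ - f₂.homogenize d₂ * g₁.homogenize d₁ ≠ 0 := by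
    intro h0
    apply hdet
    have := congrArg (aeval ![(Polynomial.X : Polynomial K), 1]) h0
    rwa [map_sub, map_mul, map_mul, map_zero, Polynomial.aeval_homogenize_X_one _ h₁.natDegree_le,
      Polynomial.aeval_homogenize_X_one _ h₂.natDegree_le,
      Polynomial.aeval_homogenize_X_one _ (hdeg h₁),
      Polynomial.aeval_homogenize_X_one _ (hdeg h₂)] at this
  have hhom : (f₁.homogenize d₁ * g₂.homogenize d₂ -
      f₂.homogenize d₂ * g₁.homogenize d₁).IsHomogeneous (d₁ + d₂) := by
    refine IsHomogeneous.sub (IsHomogeneous.mul (by simp) (by simp)) ?_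
    rw [add_comm]
    exact IsHomogeneous.mul (by simp) (by simp)
  have ht := hhom.totalDegree hD0
  have hr0 : r ≠ 0 := by
    rintro rfl
    exact hD0 (by rw [hr, mul_zero])
  rw [hr, totalDegree_mul_of_isDomain (definingPolyB2_ne_zero a b p q) hr0,
    (isHomogeneous_definingPolyB2 a b p q).totalDegree (definingPolyB2_ne_zero a b p q)] at ht
  have hrC : r = C (r.coeff 0) := totalDegree_eq_zero_iff_eq_C.1 (by omega)
  refine ⟨r.coeff 0, ?_, ?_⟩
  · intro h0
    rw [h0, C_0] at hrC
    exact hr0 hrC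
  · rw [← hrC, hr, mul_comm]

/-- The multiarrangement is free. -/
theorem exists_hasExponents_formsB2 [CharZero K] (a b p q : ℕ) :
    ∃ d : Fin 2 → ℕ, HasExponents (formsB2 K) ![a, b, p, q] d := by
  obtain ⟨d₁, d₂, F₁, G₁, F₂, G₂, ⟨hF₁, hG₁, h₁⟩, ⟨hF₂, hG₂, h₂⟩, c, hc, hdet⟩ :=
    exists_isLogPair_det_eq (K := K) a b p q
  obtain ⟨B, hB0, hB1⟩ := exists_basis_of_det_eq
    (θ₀ := mkDerivation K ![F₁, G₁]) (θ₁ := mkDerivation K ![F₂, G₂]) (a := a) (b := b) (p := p)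
    (q := q) (mem_logDerivations_formsB2_iff.2 (by simpa [mkDerivation_X] using h₁))
    (mem_logDerivations_formsB2_iff.2 (by simpa [mkDerivation_X] using h₂)) hc
    (by simpa [mkDerivation_X] using hdet)
  refine ⟨![d₁, d₂], B, ?_⟩
  rw [Fin.forall_fin_two, hB0, hB1]
  constructor
  · intro j
    fin_cases j
    · simpa [mkDerivation_X] using hF₁
    · simpa [mkDerivation_X] using hG₁
  · intro j
    fin_cases j
    · simpa [mkDerivation_X] using hF₂
    · simpa [mkDerivation_X] using hG₂

/-! ### Degrees of an arbitrary homogeneous basis -/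

section Basis

variable {a b p q : ℕ} {d : Fin 2 → ℕ}
  (B : Module.Basis (Fin 2) (MvPolynomial (Fin 2) K) (logDerivations (formsB2 K) ![a, b, p, q]))

theorem exists_coeffs_of_isLogPair {F G : MvPolynomial (Fin 2) K} (h : IsLogPair a b p q F G) :
    ∃ s t : MvPolynomial (Fin 2) K, F = s * (B 0).1 (X 0) + t * (B 1).1 (X 0) ∧
      G = s * (B 0).1 (X 1) + t * (B 1).1 (X 1) := by
  have hm : mkDerivation K ![F, G] ∈ logDerivations (formsB2 K) ![a, b, p, q] :=
    mem_logDerivations_formsB2_iff.2 (by simpa [mkDerivation_X] using h)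
  have hs := B.sum_repr ⟨_, hm⟩
  rw [Fin.sum_univ_two] at hs
  have hs' := congrArg Subtype.val hs
  refine ⟨B.repr ⟨_, hm⟩ 0, B.repr ⟨_, hm⟩ 1, ?_, ?_⟩
  · have := congrArg (fun D : Derivation K _ _ => D (X 0)) hs'
    exact (this.trans (by simp [mkDerivation_X])).symm
  · have := congrArg (fun D : Derivation K _ _ => D (X 1)) hs'
    exact (this.trans (by simp [mkDerivation_X])).symm

theorem basis_isLogPair (i : Fin 2) : IsLogPair a b p q ((B i).1 (X 0)) ((B i).1 (X 1)) :=
  mem_logDerivations_formsB2_iff.1 (B i).2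

theorem basis_ne_zero (i : Fin 2) : (B i).1 (X 0) ≠ 0 ∨ (B i).1 (X 1) ≠ 0 := by
  by_contra hc
  push Not at hc
  apply B.ne_zero i
  apply Subtype.ext
  apply derivation_ext
  rw [Fin.forall_fin_two]
  exact hc

theorem isHomogeneous_det (hB : ∀ i, IsHomogeneousDerivation (B i).1 (d i)) :
    ((B 0).1 (X 0) * (B 1).1 (X 1) - (B 1).1 (X 0) * (B 0).1 (X 1)).IsHomogeneous
      (d 0 + d 1) := by
  refine ((hB 0 0).mul (hB 1 1)).sub ?_
  rw [add_comm]
  exact (hB 1 0).mul (hB 0 1)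

variable [CharZero K]

/-- The determinant of a basis is nonzero, and the exponents add up to the total multiplicity. -/
theorem det_ne_zero_and_sum_eq (hB : ∀ i, IsHomogeneousDerivation (B i).1 (d i)) :
    (B 0).1 (X 0) * (B 1).1 (X 1) - (B 1).1 (X 0) * (B 0).1 (X 1) ≠ 0 ∧
      d 0 + d 1 = a + b + p + q := by
  obtain ⟨d₁, d₂, F₁, G₁, F₂, G₂, ⟨-, -, h₁⟩, ⟨-, -, h₂⟩, c, hc, hdet⟩ :=
    exists_isLogPair_det_eq (K := K) a b p q
  obtain ⟨s, t, hF₁, hG₁⟩ := exists_coeffs_of_isLogPair B h₁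
  obtain ⟨s', t', hF₂, hG₂⟩ := exists_coeffs_of_isLogPair B h₂
  have hQ := definingPolyB2_ne_zero (K := K) a b p q
  have hcQ : C c * definingPolyB2 K a b p q ≠ 0 := mul_ne_zero (by simpa using hc) hQ
  set δ := (B 0).1 (X 0) * (B 1).1 (X 1) - (B 1).1 (X 0) * (B 0).1 (X 1) with hδ
  -- Thus δ divides a scalar multiple of Q, while Q divides δ; comparing degrees gives the sum.
  have hmul : C c * definingPolyB2 K a b p q = δ * (s * t' - s' * t) := by
    rw [← hdet, hδ, hF₁, hG₁, hF₂, hG₂]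
    ring
  have hδ0 : δ ≠ 0 := by
    intro h0
    exact hcQ (by rw [hmul, h0, zero_mul])
  refine ⟨hδ0, ?_⟩
  have hhQ := isHomogeneous_definingPolyB2 (K := K) a b p q
  have t1 := totalDegree_le_of_dvd_of_isDomain
    ((basis_isLogPair B 0).definingPolyB2_dvd (basis_isLogPair B 1)) hδ0
  have t2 := totalDegree_le_of_dvd_of_isDomain (Dvd.intro _ hmul.symm) hcQ
  rw [(isHomogeneous_det B hB).totalDegree hδ0] at t1 t2
  rw [hhQ.totalDegree hQ] at t1
  have hhC := hhQ.C_mul c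
  rw [hhC.totalDegree hcQ] at t2
  omega

/-- A nonzero homogeneous logarithmic derivation has degree at least one of the exponents. -/
theorem exponent_le_of_isLogPair (hB : ∀ i, IsHomogeneousDerivation (B i).1 (d i))
    {F G : MvPolynomial (Fin 2) K} {n : ℕ} (h : IsLogPair a b p q F G)
    (hF : F.IsHomogeneous n) (hG : G.IsHomogeneous n) (h0 : F ≠ 0 ∨ G ≠ 0) :
    d 0 ≤ n ∨ d 1 ≤ n := by
  obtain ⟨s, t, hs, ht⟩ := exists_coeffs_of_isLogPair B h
  obtain ⟨hδ0, -⟩ := det_ne_zero_and_sum_eq B hB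
  have hδ := (isHomogeneous_det B hB).totalDegree hδ0
  rcases eq_or_ne s 0 with hs0 | hs0
  · have ht0 : t ≠ 0 := by
      rintro rfl
      simp [hs0] at hs ht
      exact h0.elim (· hs) (· ht)
    right
    -- Cramer's rule bounds the degree without needing the coefficient t to be homogeneous.
    have e : (B 0).1 (X 0) * G - F * (B 0).1 (X 1) =
        t * ((B 0).1 (X 0) * (B 1).1 (X 1) - (B 1).1 (X 0) * (B 0).1 (X 1)) := by
      rw [hs, ht]; ring
    have hh : ((B 0).1 (X 0) * G - F * (B 0).1 (X 1)).IsHomogeneous (d 0 + n) := by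
      refine ((hB 0 0).mul hG).sub ?_
      rw [add_comm]
      exact hF.mul (hB 0 1)
    have hd := hh.totalDegree (e ▸ mul_ne_zero ht0 hδ0)
    rw [e, totalDegree_mul_of_isDomain ht0 hδ0, hδ] at hd
    omega
  · left
    have e : F * (B 1).1 (X 1) - (B 1).1 (X 0) * G =
        s * ((B 0).1 (X 0) * (B 1).1 (X 1) - (B 1).1 (X 0) * (B 0).1 (X 1)) := by
      rw [hs, ht]; ring
    have hh : (F * (B 1).1 (X 1) - (B 1).1 (X 0) * G).IsHomogeneous (n + d 1) := by
      refine (hF.mul (hB 1 1)).sub ?_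
      rw [add_comm]
      exact (hB 1 0).mul hG
    have hd := hh.totalDegree (e ▸ mul_ne_zero hs0 hδ0)
    rw [e, totalDegree_mul_of_isDomain hs0 hδ0, hδ] at hd
    omega

end Basis

end LogPairs

/-! ### Counting exponents in degree e -/

/-- The difference of the exponents of `x ^ a * y ^ b * (x ^ 2 - y ^ 2) ^ k` of even total
multiplicity `2 * e + 2`, in the balanced case. -/
theorem abs_sub_exponents_eq_two_iff {K : Type*} [Field K] [CharZero K] {a b k e : ℕ}
    (hk : 0 < k) (ha : a ≤ e) (hb : b ≤ e) (he : a + b + k + k = 2 * e + 2)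
    {d : Fin 2 → ℕ} (hd : HasExponents (formsB2 K) ![a, b, k, k] d) :
    |(d 0 : ℤ) - d 1| = 2 ↔ Odd a ∧ Odd b ∧ Odd e := by
  obtain ⟨B, hB⟩ := hd
  have hsum := (det_ne_zero_and_sum_eq B hB).2
  have haff : ∀ i, ∃ f g : Polynomial K, Polynomial.IsAffineLogPair a b k k (d i) f g ∧
      ¬ (f = 0 ∧ g = 0) := fun i =>
    ⟨_, _, (basis_isLogPair B i).isAffineLogPair (hB i 0) (hB i 1), by
      rw [aeval_eq_zero_iff (hB i 0), aeval_eq_zero_iff (hB i 1), not_and_or]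
      exact basis_ne_zero B i⟩
  constructor
  · intro habs
    obtain ⟨i, hi⟩ : ∃ i, d i = e := by
      rcases abs_eq (by norm_num : (0 : ℤ) ≤ 2) |>.1 habs with h | h
      · exact ⟨1, by omega⟩
      · exact ⟨0, by omega⟩
    obtain ⟨f, g, h, h0⟩ := haff i
    rw [hi] at h
    by_contra hc
    apply h0
    simp only [Nat.odd_iff] at hc
    -- Since a + b is even, a and b have the same parity; unless a, b, e are all odd, each class has
    -- exactly k exponents.
    exact h.eq_zero (by omega) (by omega)
  · rintro ⟨⟨a', rfl⟩, ⟨b', rfl⟩, ⟨e', rfl⟩⟩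
    have hge : ∀ i, 2 * e' + 1 ≤ d i := by
      intro i
      obtain ⟨f, g, h, h0⟩ := haff i
      by_contra hlt
      exact h0 (h.eq_zero (by omega) (by omega))
    -- Here the class of f odd, g even has k + 1 exponents.
    obtain ⟨f, g, h, h0⟩ := Polynomial.exists_isAffineLogPair_of_lt (K := K) (a := 2 * a' + 1)
      (b := 2 * b' + 1) (k := k) (d := 2 * e' + 1) (by omega)
    have hgd : g.natDegree ≤ 2 * e' + 1 := by
      rcases eq_or_ne g 0 with hg | hg
      · simp [hg]
      · have := h.natDegree_add_le hg
        omega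
    have hle := exponent_le_of_isLogPair B hB h.isLogPair
      (Polynomial.isHomogeneous_homogenize _) (Polynomial.isHomogeneous_homogenize _)
      (by rwa [Ne, Ne, Polynomial.homogenize_eq_zero_iff h.natDegree_le,
        Polynomial.homogenize_eq_zero_iff hgd])
    have h1 := hge 0
    have h2 := hge 1
    rw [abs_eq (by norm_num)]
    omega

theorem corollary3p21 {K : Type*} [Field K] [CharZero K]
    (m₁ m₂ m₃ m₄ : ℕ) (hm₁ : 0 < m₁) (hm₂ : 0 < m₂) (hm₃ : 0 < m₃) (hm₄ : 0 < m₄)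
    (hbal : IsBalanced ![m₁, m₂, m₃, m₄])
    (hge : |(m₂ : ℤ) - m₁| ≥ |(m₄ : ℤ) - m₃|) (hzero : |(m₄ : ℤ) - m₃| = 0) :
    (∃ d : Fin 2 → ℕ, HasExponents (formsB2 K) ![m₁, m₂, m₃, m₄] d) ∧
    ∀ d : Fin 2 → ℕ, HasExponents (formsB2 K) ![m₁, m₂, m₃, m₄] d →
      (|(d 0 : ℤ) - d 1| = 2 ↔
        Odd m₁ ∧ Odd m₂ ∧
          ∃ e : ℤ, (e : ℚ) = ((m₁ + m₂ + m₃ + m₄ : ℕ) : ℚ) / 2 - 1 ∧ Odd e) := by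
  refine ⟨exists_hasExponents_formsB2 _ _ _ _, fun d hd => ?_⟩
  obtain rfl : m₄ = m₃ := by
    have := abs_eq_zero.1 hzero
    omega
  have hbal' : ∀ i, 2 * (![m₁, m₂, m₄, m₄] i) < m₁ + m₂ + m₄ + m₄ := by
    intro i
    have h := hbal i
    rw [lt_div_iff₀ two_pos, mul_comm] at h
    have h' : 2 * (![m₁, m₂, m₄, m₄] i) < ∑ j, ![m₁, m₂, m₄, m₄] j := by exact_mod_cast h
    simpa [Fin.sum_univ_four] using h'
  have hb1 : 2 * m₁ < m₁ + m₂ + m₄ + m₄ := hbal' 0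
  have hb2 : 2 * m₂ < m₁ + m₂ + m₄ + m₄ := hbal' 1
  have hint : ∀ e : ℤ, (e : ℚ) = ((m₁ + m₂ + m₄ + m₄ : ℕ) : ℚ) / 2 - 1 ↔
      2 * e + 2 = m₁ + m₂ + m₄ + m₄ := by
    intro e
    have : (e : ℚ) = ((m₁ + m₂ + m₄ + m₄ : ℕ) : ℚ) / 2 - 1 ↔
        2 * (e : ℚ) + 2 = ((m₁ + m₂ + m₄ + m₄ : ℕ) : ℚ) := by
      constructor <;> intro h <;> linarith
    rw [this]
    exact_mod_cast Iff.rfl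
  simp only [hint]
  rcases Nat.even_or_odd (m₁ + m₂ + m₄ + m₄) with ⟨n, hn⟩ | ⟨n, hn⟩
  · obtain ⟨e, rfl⟩ : ∃ e, n = e + 1 := ⟨n - 1, by omega⟩
    rw [abs_sub_exponents_eq_two_iff hm₃ (e := e) (by omega) (by omega) (by omega) hd]
    refine and_congr_right fun _ => and_congr_right fun _ => ⟨fun h => ⟨e, by omega, ?_⟩, ?_⟩
    · exact_mod_cast h
    · rintro ⟨e', he', ho⟩
      obtain rfl : e' = e := by omega
      exact_mod_cast ho
  -- For odd |m| the difference of the exponents is odd and no integer e exists.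
  · obtain ⟨B, hB⟩ := hd
    have hsum := (det_ne_zero_and_sum_eq B hB).2
    constructor
    · intro h
      rcases abs_eq (by norm_num : (0 : ℤ) ≤ 2) |>.1 h with h | h <;> omega
    · rintro ⟨-, -, e, he, -⟩
      omega
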